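/- Let $d\ge 1$, $k\ge 2$ and $0\le\beta\le k-1$ be integers. For $z\in\mathbb{C}^d$ write $|z|=\sqrt{|z_1|^2+\cdots+|z_d|^2}$. For a polynomial $Q\in\mathbb{C}[z_1,\dots,z_d]$ let $Q^{*}$ be the polynomial obtained by conjugating the coefficients of $Q$, and let $Q(D)$ be the linear differential operator obtained by replacing each variable $z_i$ with $\partial/\partial z_i$. The order of an entire function $f:\mathbb{C}^d\to\mathbb{C}$ is $$\rho(f)=\limsup_{r\to\infty}\frac{\log\log M(f,r)}{\log r},\qquad M(f,r)=\sup\{|f(z)|: z\in\mathbb{C}^d,\ |z|=r\},$$ with the convention that constant functions have order $0$. Let $P\in\mathbb{C}[z_1,\dots,z_d]$ be a non-homogeneous polynomial of degree $k$ with expansion into homogeneous parts $P=P_0+\cdots+P_\beta+P_k$, where $P_j$ is the homogeneous part of degree $j$ (so $P_j=0$ for $\beta<j<k$, and $P_0,\dots,P_\beta$ may individually vanish). Let $\varphi:\mathbb{C}^d\to\mathbb{C}$ be an entire function satisfying $$P_k^{*}(D)(P\varphi)=0$$ whose order $\rho$ satisfies $\rho<\dfrac{2(k-\beta)}{k}$.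 Then $\varphi=0$. -/

import Mathlib

noncomputable section

namespace Fischer

variable {d : ℕ}

/-- The complex partial derivative `∂f/∂z_i` of a function on `ℂ^d`. -/
def partialD (i : Fin d) (f : EuclideanSpace ℂ (Fin d) → ℂ) : EuclideanSpace ℂ (Fin d) → ℂ :=
  fun z => fderiv ℂ f z (EuclideanSpace.single i 1)

/-- The iterated partial derivative `∂^α f = ∂_1^{α_1} ⋯ ∂_d^{α_d} f` for a multi-index `α`. -/
def multiD (α : Fin d →₀ ℕ) (f : EuclideanSpace ℂ (Fin d) → ℂ) : EuclideanSpace ℂ (Fin d) → ℂ :=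
  (List.finRange d).foldr (fun i g => (partialD i)^[α i] g) f

/-- The differential operator `Q(D)`: each variable `z_i` of `Q` is replaced by `∂/∂z_i`. -/
def diffOp (Q : MvPolynomial (Fin d) ℂ) (f : EuclideanSpace ℂ (Fin d) → ℂ) :
    EuclideanSpace ℂ (Fin d) → ℂ :=
  fun z => ∑ α ∈ Q.support, Q.coeff α * multiD α f z

/-- The polynomial `P^*`, obtained from `P` by conjugating its coefficients. -/
def conjCoeffs (P : MvPolynomial (Fin d) ℂ) : MvPolynomial (Fin d) ℂ :=
  MvPolynomial.map (starRingEnd ℂ) P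

/-- `M(f, r) = sup {|f(z)| : |z| = r}`, where `|z|` is the Euclidean norm on `ℂ^d`. -/
def maxModulus (f : EuclideanSpace ℂ (Fin d) → ℂ) (r : ℝ) : ℝ :=
  sSup {x : ℝ | ∃ z : EuclideanSpace ℂ (Fin d), ‖z‖ = r ∧ x = ‖f z‖}

/-- The order `limsup_{r → ∞} log log M(f, r) / log r` of an entire function, as an extended real
number. For a nonconstant entire function (`d ≥ 1`) both logarithms have positive arguments for
large `r`; for a constant function the conventions of `Real.log` give the usual value `0`. -/
def order (f : EuclideanSpace ℂ (Fin d) → ℂ) : EReal :=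
  Filter.limsup
    (fun r : ℝ => ((Real.log (Real.log (maxModulus f r)) / Real.log r : ℝ) : EReal)) Filter.atTop

end Fischer

end

/-!
Let `f_n` be the homogeneous part of degree `n` of the Taylor expansion of `φ` at `0`. For the
Fischer inner product `⟨p, q⟩ = (p^*(D) q)(0)` on polynomials, `p^*(D)` is the adjoint of
multiplication by `p`, so the equation says that the expansion of `P φ` is orthogonal to every
multiple of `P_k`. Testing it against `P_k f_m` gives `‖P_k f_m‖ ≤ ‖∑_{j ≤ β} P_j f_{m+k-j}‖`.
Bombieri's inequality `‖P_k‖ ‖f_m‖ ≤ ‖P_k f_m‖` on the left and the cruder bound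
`‖P_j f_n‖ ≤ S_j (n + j)^{j/2} ‖f_n‖` on the right turn this into a recursive inequality which
bounds `‖f_m‖` by the norms of *later* Taylor parts.

With `g = β / (2 (k - β))` the weights `(n!)^g` absorb the powers of `n`, so that
`b_n = (n!)^g ‖f_n‖` satisfies `b_m ≤ ∑_{j ≤ β} U_j b_{m+k-j}` with constant coefficients. If `φ`
has order less than `T = 2 (k - β) / k`, Cauchy's estimates bound `‖f_n‖` by `(n!)^{1/2 - 1/s}` up
to a geometric factor, for some `s < T`. Since `g + 1/2 = 1/T`, the `b_n` decay faster than any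
geometric sequence, and the recursive inequality then leaves only `b_n = 0`.
-/

noncomputable section

namespace Fischer

section Smoothness

variable {E : Type*} [NormedAddCommGroup E] [NormedSpace ℂ E]

lemma hasDerivAt_comp_line {f : E → ℂ} (hf : Differentiable ℂ f) (z v : E) (t : ℂ) :
    HasDerivAt (fun s : ℂ => f (z + s • v)) (fderiv ℂ f (z + t • v) v) t := by
  have hline : HasDerivAt (fun s : ℂ => z + s • v) v t := by
    simpa using ((hasDerivAt_id t).smul_const v).const_add z
  exact (hf _).hasFDerivAt.comp_hasDerivAt t hline

lemma differentiable_comp_line {f : E → ℂ} (hf : Differentiable ℂ f) (z v : E) :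
    Differentiable ℂ (fun s : ℂ => f (z + s • v)) :=
  fun t => (hasDerivAt_comp_line hf z v t).differentiableAt

lemma norm_fderiv_apply_le {f : E → ℂ} (hf : Differentiable ℂ f) (z v : E) {r C : ℝ} (hr : 0 < r)
    (hC : ∀ w, ‖w - z‖ ≤ r * ‖v‖ → ‖f w‖ ≤ C) : ‖fderiv ℂ f z v‖ ≤ C / r := by
  have hder := (hasDerivAt_comp_line hf z v 0).deriv
  simp only [zero_smul, add_zero] at hder
  rw [← hder]
  refine Complex.norm_deriv_le_of_forall_mem_sphere_norm_le hr
    (differentiable_comp_line hf z v).diffContOnCl fun t ht => hC _ ?_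
  rw [add_sub_cancel_left, norm_smul, mem_sphere_zero_iff_norm.1 ht]

lemma norm_fderiv_le {f : E → ℂ} (hf : Differentiable ℂ f) (z : E) {C : ℝ}
    (hC : ∀ w, ‖w - z‖ ≤ 1 → ‖f w‖ ≤ C) : ‖fderiv ℂ f z‖ ≤ C := by
  refine ContinuousLinearMap.opNorm_le_bound _ ((norm_nonneg _).trans (hC z (by simp)))
    fun v => ?_
  rcases eq_or_ne v 0 with rfl | hv
  · simp
  have hv' : 0 < ‖v‖ := norm_pos_iff.2 hv
  simpa [div_inv_eq_mul] using norm_fderiv_apply_le hf z v (inv_pos.2 hv')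
    fun w hw => hC w (by rwa [inv_mul_cancel₀ hv'.ne'] at hw)

lemma fderiv_apply_eq_circleIntegral {f : E → ℂ} (hf : Differentiable ℂ f) (z v : E) :
    fderiv ℂ f z v = (2 * Real.pi * Complex.I : ℂ)⁻¹ •
      ∮ ζ in C(0, 1), (1 / (ζ - 0) ^ 2) • f (z + ζ • v) := by
  rw [((differentiable_comp_line hf z v).differentiableOn).deriv_eq_smul_circleIntegral one_pos,
    (hasDerivAt_comp_line hf z v 0).deriv, inv_smul_smul₀ Complex.two_pi_I_ne_zero]
  simp

variable [FiniteDimensional ℂ E]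

lemma exists_norm_fderiv_le_near {f : E → ℂ} (hf : Differentiable ℂ f) {u : ℝ → E}
    (hu : Continuous u) (a b : ℝ) (z : E) :
    ∃ C : ℝ, ∀ w ∈ Metric.ball z 1, ∀ θ ∈ Set.uIoc a b, ‖fderiv ℂ f (w + u θ)‖ ≤ C := by
  have := FiniteDimensional.proper ℂ E
  obtain ⟨C, hC⟩ := ((isCompact_closedBall z 2).add
    (isCompact_uIcc.image hu)).exists_bound_of_continuousOn hf.continuous.continuousOn
  refine ⟨C, fun w hw θ hθ => norm_fderiv_le hf _ fun y hy => hC y ?_⟩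
  refine ⟨y - u θ, ?_, u θ, ⟨θ, Set.uIoc_subset_uIcc hθ, rfl⟩, sub_add_cancel _ _⟩
  rw [mem_closedBall_iff_norm]
  calc ‖y - u θ - z‖ = ‖(y - (w + u θ)) + (w - z)‖ := by congr 1; abel
    _ ≤ 1 + 1 := norm_add_le_of_le hy (mem_ball_iff_norm.1 hw).le
    _ = 2 := by norm_num

lemma differentiable_intervalIntegral_translate {f : E → ℂ} (hf : Differentiable ℂ f) {c : ℝ → ℂ}
    (hc : Continuous c) {u : ℝ → E} (hu : Continuous u) (a b : ℝ) :
    Differentiable ℂ fun z => ∫ θ in a..b, c θ • f (z + u θ) := by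
  intro z
  obtain ⟨C, hC⟩ := exists_norm_fderiv_le_near hf hu a b z
  have hF : ∀ w, Continuous fun θ => c θ • f (w + u θ) := fun w =>
    hc.smul (hf.continuous.comp (continuous_const.add hu))
  refine (intervalIntegral.hasFDerivAt_integral_of_dominated_of_fderiv_le
    (F' := fun w θ => c θ • fderiv ℂ f (w + u θ)) (bound := fun θ => ‖c θ‖ * C)
    (Metric.ball_mem_nhds z one_pos)
    (Filter.Eventually.of_forall fun w => (hF w).aestronglyMeasurable)
    ((hF z).intervalIntegrable _ _) ?_ ?_ ((hc.norm.mul continuous_const).intervalIntegrable _ _)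
    ?_).differentiableAt
  · have := FiniteDimensional.proper ℂ (E →L[ℂ] ℂ)
    borelize E
    exact (hc.measurable.smul ((measurable_fderiv ℂ f).comp
      (continuous_const.add hu).measurable)).aestronglyMeasurable
  · refine Filter.Eventually.of_forall fun θ hθ w hw => ?_
    rw [norm_smul]
    gcongr
    exact hC w hw θ hθ
  · exact Filter.Eventually.of_forall fun θ _ w _ =>
      ((hasFDerivAt_comp_add_right (u θ)).2 (hf (w + u θ)).hasFDerivAt).const_smul (c θ)

lemma differentiable_fderiv_apply {f : E → ℂ} (hf : Differentiable ℂ f) (v : E) :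
    Differentiable ℂ fun z => fderiv ℂ f z v := by
  have hc : Continuous fun θ => deriv (circleMap 0 1) θ * (1 / (circleMap 0 1 θ - 0) ^ 2) := by
    simp only [deriv_circleMap]
    exact Continuous.mul (by fun_prop) (Continuous.div (by fun_prop) (by fun_prop) (by simp))
  have hu : Continuous fun θ => circleMap 0 1 θ • v := by fun_prop
  simp only [fderiv_apply_eq_circleIntegral hf _ v, circleIntegral, smul_smul]
  exact (differentiable_intervalIntegral_translate hf hc hu 0 (2 * Real.pi)).fun_const_smul
    (R := ℂ) _

lemma fderiv_fderiv_apply_comm {f : E → ℂ} (hf : Differentiable ℂ f) (v w z : E) :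
    fderiv ℂ (fun y => fderiv ℂ f y v) z w = fderiv ℂ (fun y => fderiv ℂ f y w) z v := by
  have hC1 : ∀ {g : E → ℂ}, Differentiable ℂ g → ContDiff ℂ 1 g := fun hg =>
    contDiff_one_iff_fderiv.2
      ⟨hg, continuous_clm_apply.2 fun y => (differentiable_fderiv_apply hg y).continuous⟩
  have hdiff : Differentiable ℂ (fderiv ℂ f) :=
    (contDiff_clm_apply_iff.2 fun y => hC1 (differentiable_fderiv_apply hf y)).differentiable
      one_ne_zero
  have hsymm : fderiv ℂ (fderiv ℂ f) z w v = fderiv ℂ (fderiv ℂ f) z v w :=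
    second_derivative_symmetric (fun y => (hf y).hasFDerivAt) (hdiff z).hasFDerivAt w v
  simpa [fderiv_clm_apply (hdiff z) (differentiableAt_const _)] using hsymm

end Smoothness

section Order

open Filter

lemma le_exp_rpow_of_log_log_div_log_lt {x r s : ℝ} (hr : 1 < r)
    (h : Real.log (Real.log x) / Real.log r < s) : x ≤ Real.exp (r ^ s) := by
  rcases le_or_gt x 1 with hx | hx
  · exact hx.trans (Real.one_le_exp (by positivity))
  have hlog : 0 < Real.log x := Real.log_pos hx
  rw [div_lt_iff₀ (Real.log_pos hr), Real.log_lt_iff_lt_exp hlog, mul_comm,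
    ← Real.rpow_def_of_pos (by linarith)] at h
  exact (Real.log_le_iff_le_exp (by linarith)).1 h.le

variable {d : ℕ} {f : EuclideanSpace ℂ (Fin d) → ℂ}

lemma norm_le_maxModulus (hf : Continuous f) (z : EuclideanSpace ℂ (Fin d)) :
    ‖f z‖ ≤ maxModulus f ‖z‖ := by
  obtain ⟨C, hC⟩ := (isCompact_sphere (0 : EuclideanSpace ℂ (Fin d)) ‖z‖)
    |>.exists_bound_of_continuousOn hf.continuousOn
  refine le_csSup ⟨C, ?_⟩ ⟨z, rfl, rfl⟩
  rintro x ⟨w, hw, rfl⟩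
  exact hC w (by simpa using hw)

lemma exists_norm_le_mul_exp_rpow_of_order_lt (hf : Continuous f) {s : ℝ}
    (hs : order f < (s : EReal)) : ∃ C : ℝ, ∀ z, ‖f z‖ ≤ C * Real.exp (‖z‖ ^ s) := by
  obtain ⟨R, hR⟩ := eventually_atTop.1 ((eventually_lt_of_limsup_lt hs).and (eventually_gt_atTop 1))
  obtain ⟨C, hC⟩ := (isCompact_closedBall (0 : EuclideanSpace ℂ (Fin d)) R)
    |>.exists_bound_of_continuousOn hf.continuousOn
  refine ⟨max C 1, fun z => ?_⟩
  rcases le_total ‖z‖ R with hz | hz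
  · calc ‖f z‖ ≤ max C 1 := (hC z (by simpa using hz)).trans (le_max_left _ _)
      _ ≤ max C 1 * Real.exp (‖z‖ ^ s) :=
        le_mul_of_one_le_right (by positivity) (Real.one_le_exp (by positivity))
  · obtain ⟨hlt, hone⟩ := hR ‖z‖ hz
    calc ‖f z‖ ≤ maxModulus f ‖z‖ := norm_le_maxModulus hf z
      _ ≤ Real.exp (‖z‖ ^ s) := le_exp_rpow_of_log_log_div_log_lt hone (EReal.coe_lt_coe_iff.1 hlt)
      _ ≤ max C 1 * Real.exp (‖z‖ ^ s) :=
        le_mul_of_one_le_left (by positivity) (le_max_right _ _)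

lemma exists_pos_lt_forall_norm_le_of_order_lt (hf : Continuous f) {T : ℝ} (hT : 0 < T)
    (hord : order f < (T : EReal)) :
    ∃ s, 0 < s ∧ s < T ∧ ∃ C : ℝ, ∀ z, ‖f z‖ ≤ C * Real.exp (‖z‖ ^ s) := by
  obtain ⟨t, hft, htT⟩ := EReal.lt_iff_exists_real_btwn.1 hord
  exact ⟨max t (T / 2), lt_max_of_lt_right (by positivity),
    max_lt (EReal.coe_lt_coe_iff.1 htT) (half_lt_self hT),
    exists_norm_le_mul_exp_rpow_of_order_lt hf
      (hft.trans_le (EReal.coe_le_coe_iff.2 (le_max_left _ _)))⟩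

end Order

section Recursion

lemma eq_zero_of_le_sum_of_bddAbove {ι : Type*} {s : Finset ι} {U : ι → ℝ} {e : ι → ℕ}
    {b : ℕ → ℝ} {A : ℝ} (hU : ∀ i ∈ s, 0 ≤ U i) (he : ∀ i ∈ s, 0 < e i) (hb : ∀ n, 0 ≤ b n)
    (hrec : ∀ n, b n ≤ ∑ i ∈ s, U i * b (n + e i)) (hA : 1 ≤ A) (hUA : ∑ i ∈ s, U i < A)
    (hbdd : BddAbove (Set.range fun n => A ^ n * b n)) (n : ℕ) : b n = 0 := by
  set c : ℕ → ℝ := fun n => A ^ n * b n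
  have hA_pos : 0 < A := by linarith
  have hstep : ∀ n, A * c n ≤ (∑ i ∈ s, U i) * ⨆ m, c m := fun n => by
    calc A * c n = A ^ (n + 1) * b n := by simp only [c]; ring
      _ ≤ A ^ (n + 1) * ∑ i ∈ s, U i * b (n + e i) := by gcongr; exact hrec n
      _ = ∑ i ∈ s, U i * (A ^ (n + 1) * b (n + e i)) := by
        rw [Finset.mul_sum]
        exact Finset.sum_congr rfl fun i _ => by ring
      _ ≤ ∑ i ∈ s, U i * ⨆ m, c m := by
        refine Finset.sum_le_sum fun i hi => mul_le_mul_of_nonneg_left ?_ (hU i hi)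
        exact (mul_le_mul_of_nonneg_right (pow_le_pow_right₀ hA (by have := he i hi; lia))
          (hb _)).trans (le_ciSup hbdd (n + e i))
      _ = (∑ i ∈ s, U i) * ⨆ m, c m := (Finset.sum_mul _ _ _).symm
  have hsup : A * ⨆ m, c m ≤ (∑ i ∈ s, U i) * ⨆ m, c m := by
    rw [Real.mul_iSup_of_nonneg hA_pos.le]
    exact ciSup_le hstep
  have hsup_nonpos : ⨆ m, c m ≤ 0 := by nlinarith
  have hn : A ^ n * b n ≤ 0 := (le_ciSup hbdd n).trans hsup_nonpos
  exact le_antisymm (nonpos_of_mul_nonpos_right hn (by positivity)) (hb n)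

open scoped Nat in
lemma factorial_rpow_mul_sqrt_pow_le {k j n : ℕ} (hk : 1 ≤ k) {g : ℝ} (hg : 0 ≤ g)
    (hj : j ≤ 2 * g * n) (m : ℕ) :
    (m ! : ℝ) ^ g * √(m + k) ^ j ≤ √k ^ j * ((m + n)! : ℝ) ^ g := by
  have hk' : (1 : ℝ) ≤ k := by exact_mod_cast hk
  have hsqrt : √(m + k : ℝ) ≤ √k * √(m + 1) := by
    rw [← Real.sqrt_mul (by positivity)]
    exact Real.sqrt_le_sqrt (by nlinarith [m.cast_nonneg (α := ℝ)])
  have hexponent : √(m + 1 : ℝ) ^ j ≤ ((m + 1 : ℝ) ^ n) ^ g := by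
    rw [Real.sqrt_eq_rpow, ← Real.rpow_mul_natCast (by positivity),
      ← Real.rpow_natCast_mul (by positivity)]
    exact Real.rpow_le_rpow_of_exponent_le (by simp) (by linarith)
  have hfactorial : (m ! : ℝ) * (m + 1 : ℝ) ^ n ≤ ((m + n)! : ℝ) := by
    exact_mod_cast Nat.factorial_mul_pow_le_factorial
  calc (m ! : ℝ) ^ g * √(m + k) ^ j ≤ (m ! : ℝ) ^ g * (√k * √(m + 1)) ^ j := by gcongr
    _ = √k ^ j * ((m ! : ℝ) ^ g * √(m + 1) ^ j) := by ring
    _ ≤ √k ^ j * ((m ! : ℝ) ^ g * ((m + 1 : ℝ) ^ n) ^ g) := by gcongr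
    _ = √k ^ j * ((m ! : ℝ) * (m + 1 : ℝ) ^ n) ^ g := by
      rw [Real.mul_rpow (by positivity) (by positivity)]
    _ ≤ √k ^ j * ((m + n)! : ℝ) ^ g := by gcongr

end Recursion

open MvPolynomial
open scoped Nat ComplexConjugate

section ConstantCoefficientOperators

variable {σ R A : Type*} [CommSemiring R] [CommSemiring A] [Algebra R A]

open scoped IsMulCommutative in
/-- The operator `Q(D)` attached to a polynomial `Q` and to pairwise commuting derivations `D i` of
a commutative algebra. It is obtained by evaluating `Q` in the commutative subalgebra of the
endomorphism algebra which the `D i` generate. -/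
def constCoeffOp (D : σ → Derivation R A A)
    (hD : ∀ i j, Commute (D i).toLinearMap (D j).toLinearMap) :
    MvPolynomial σ R →ₐ[R] Module.End R A :=
  haveI := Algebra.isMulCommutative_adjoin R (s := Set.range fun i => (D i).toLinearMap)
    (by rintro _ ⟨i, rfl⟩ _ ⟨j, rfl⟩; exact hD i j)
  (Algebra.adjoin R (Set.range fun i => (D i).toLinearMap)).val.comp
    (aeval fun i => ⟨(D i).toLinearMap, Algebra.subset_adjoin ⟨i, rfl⟩⟩)

variable {D : σ → Derivation R A A} {hD : ∀ i j, Commute (D i).toLinearMap (D j).toLinearMap}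

lemma constCoeffOp_X_apply (i : σ) (a : A) : constCoeffOp D hD (X i) a = D i a := by
  simp [constCoeffOp]

lemma constCoeffOp_mul_X_apply (Q : MvPolynomial σ R) (i : σ) (a : A) :
    constCoeffOp D hD (Q * X i) a = constCoeffOp D hD Q (D i a) := by
  rw [map_mul, Module.End.mul_apply, constCoeffOp_X_apply]

lemma constCoeffOp_apply_mul {x : A} {i : σ} (hx : D i x = 1) (hx' : ∀ j ≠ i, D j x = 0)
    (Q : MvPolynomial σ R) (a : A) :
    constCoeffOp D hD Q (x * a) = x * constCoeffOp D hD Q a + constCoeffOp D hD (pderiv i Q) a := by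
  induction Q using MvPolynomial.induction_on generalizing a with
  | C c => simp [← algebraMap_eq]
  | add p q hp hq => simp only [map_add, LinearMap.add_apply, hp, hq, mul_add]; abel
  | mul_X p j hp =>
    have hpderiv : pderiv i (p * X j) = p * pderiv i (X j) + pderiv i p * X j := by
      rw [Derivation.leibniz, smul_eq_mul, smul_eq_mul, mul_comm (X j)]
    rw [constCoeffOp_mul_X_apply, constCoeffOp_mul_X_apply, Derivation.leibniz, smul_eq_mul,
      smul_eq_mul, map_add, hp, hpderiv, map_add, LinearMap.add_apply, constCoeffOp_mul_X_apply]
    rcases eq_or_ne j i with rfl | hji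
    · simp only [hx, pderiv_X_self, mul_one, add_assoc, add_comm]
    · simp only [hx' j hji, pderiv_X_of_ne hji, mul_zero, map_zero, LinearMap.zero_apply, zero_add,
        add_zero]

end ConstantCoefficientOperators

section PolynomialOperators

variable {σ R : Type*} [CommRing R]

lemma commute_pderiv (i j : σ) :
    Commute (pderiv (R := R) i).toLinearMap (pderiv (R := R) j).toLinearMap := by
  classical
  have hcomm : ⁅pderiv (R := R) i, pderiv j⁆ = 0 := MvPolynomial.derivation_ext fun l => by
    rw [Derivation.commutator_apply, pderiv_X, pderiv_X]
    simp [Pi.single_apply, apply_ite]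
  rw [commute_iff_lie_eq]
  exact congrArg Derivation.toLinearMap hcomm

/-- The constant coefficient operator `P(∂)` on polynomials, multiplicative in `P`. -/
def polyOp : MvPolynomial σ R →ₐ[R] Module.End R (MvPolynomial σ R) :=
  constCoeffOp pderiv commute_pderiv

lemma polyOp_X_apply (i : σ) (Q : MvPolynomial σ R) : polyOp (X i) Q = pderiv i Q :=
  constCoeffOp_X_apply i Q

lemma polyOp_X_mul (P Q : MvPolynomial σ R) (i : σ) :
    polyOp P (X i * Q) = X i * polyOp P Q + polyOp (pderiv i P) Q :=
  constCoeffOp_apply_mul (pderiv_X_self i) (fun _ hj => pderiv_X_of_ne hj.symm) P Q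

lemma map_polyOp {S : Type*} [CommRing S] (ψ : R →+* S) (P Q : MvPolynomial σ R) :
    map ψ (polyOp P Q) = polyOp (map ψ P) (map ψ Q) := by
  induction P using MvPolynomial.induction_on generalizing Q with
  | C a =>
    rw [map_C, ← algebraMap_eq, ← algebraMap_eq, AlgHom.commutes, AlgHom.commutes,
      Module.algebraMap_end_apply, Module.algebraMap_end_apply, smul_eq_C_mul, smul_eq_C_mul,
      map_mul, map_C]
  | add p q hp hq => simp [hp, hq]
  | mul_X p i hp =>
    rw [polyOp, constCoeffOp_mul_X_apply, ← polyOp, hp, ← pderiv_map, map_mul, map_X, polyOp,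
      constCoeffOp_mul_X_apply, ← polyOp]

end PolynomialOperators

section EntireFunctions

section Algebra

variable {E : Type*} [NormedAddCommGroup E] [NormedSpace ℂ E]

variable (E) in
/-- The algebra of entire functions on `E`. -/
def entire : Subalgebra ℂ (E → ℂ) where
  carrier := {f | Differentiable ℂ f}
  mul_mem' hf hg := hf.mul hg
  add_mem' hf hg := hf.add hg
  algebraMap_mem' c := differentiable_const c

variable [FiniteDimensional ℂ E]

/-- The derivative in the direction `v`, as a derivation of the algebra of entire functions. -/
def dirDeriv (v : E) : Derivation ℂ (entire E) (entire E) :=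
  Derivation.mk'
    { toFun := fun f => ⟨fun z => fderiv ℂ (f : E → ℂ) z v, differentiable_fderiv_apply f.2 v⟩
      map_add' := fun f g => by
        ext z
        simp [fderiv_add (f.2 z) (g.2 z)]
      map_smul' := fun c f => by
        ext z
        simp [fderiv_const_smul (f.2 z) c] }
    fun f g => by
      ext z
      simp [fderiv_mul (f.2 z) (g.2 z)]

lemma dirDeriv_apply (v : E) (f : entire E) (z : E) :
    (dirDeriv v f : E → ℂ) z = fderiv ℂ f z v :=
  rfl

lemma commute_dirDeriv (v w : E) :
    Commute (dirDeriv v).toLinearMap (dirDeriv w).toLinearMap :=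
  LinearMap.ext fun f => Subtype.ext <| funext fun z => fderiv_fderiv_apply_comm f.2 w v z

end Algebra

variable {d : ℕ}

/-- The differential operator `Q(D)` as an endomorphism of the space of entire functions on `ℂ^d`,
multiplicative in `Q`. -/
def entireOp (d : ℕ) :
    MvPolynomial (Fin d) ℂ →ₐ[ℂ] Module.End ℂ (entire (EuclideanSpace ℂ (Fin d))) :=
  constCoeffOp (fun i => dirDeriv (EuclideanSpace.single i 1)) fun _ _ => commute_dirDeriv _ _

lemma coe_entireOp_X (i : Fin d) (f : entire (EuclideanSpace ℂ (Fin d))) :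
    (entireOp d (X i) f : EuclideanSpace ℂ (Fin d) → ℂ) = partialD i f := by
  rw [entireOp, constCoeffOp_X_apply]
  rfl

lemma coe_entireOp_X_pow (i : Fin d) (n : ℕ) (f : entire (EuclideanSpace ℂ (Fin d))) :
    (entireOp d (X i ^ n) f : EuclideanSpace ℂ (Fin d) → ℂ) = (partialD i)^[n] f := by
  induction n with
  | zero => simp
  | succ n ih =>
    rw [pow_succ', map_mul, Module.End.mul_apply, coe_entireOp_X, ih, Function.iterate_succ_apply']

lemma coe_entireOp_list_prod (α : Fin d →₀ ℕ) (l : List (Fin d))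
    (f : entire (EuclideanSpace ℂ (Fin d))) :
    (entireOp d (l.map fun i => X i ^ α i).prod f : EuclideanSpace ℂ (Fin d) → ℂ) =
      l.foldr (fun i g => (partialD i)^[α i] g) f := by
  induction l with
  | nil => simp
  | cons i l ih =>
    rw [List.map_cons, List.prod_cons, map_mul, Module.End.mul_apply, coe_entireOp_X_pow, ih,
      List.foldr_cons]

lemma coe_entireOp_monomial (α : Fin d →₀ ℕ) (f : entire (EuclideanSpace ℂ (Fin d))) :
    (entireOp d (monomial α 1) f : EuclideanSpace ℂ (Fin d) → ℂ) = multiD α f := by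
  rw [multiD, ← coe_entireOp_list_prod, ← Fin.prod_univ_def, monomial_eq, C_1, one_mul,
    Finsupp.prod_fintype _ _ fun _ => pow_zero _]

lemma entireOp_apply (Q : MvPolynomial (Fin d) ℂ) (f : entire (EuclideanSpace ℂ (Fin d)))
    (z : EuclideanSpace ℂ (Fin d)) :
    (entireOp d Q f : EuclideanSpace ℂ (Fin d) → ℂ) z = diffOp Q f z := by
  conv_lhs => rw [Q.as_sum, map_sum]
  simp only [LinearMap.sum_apply, AddSubmonoidClass.coe_finsetSum, Finset.sum_apply, diffOp]
  refine Finset.sum_congr rfl fun α _ => ?_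
  rw [← coe_entireOp_monomial, ← mul_one (coeff α Q), ← smul_eq_mul, ← smul_monomial, map_smul]
  simp

/-- The entire function defined by a polynomial. -/
def polyFun (d : ℕ) : MvPolynomial (Fin d) ℂ →ₐ[ℂ] entire (EuclideanSpace ℂ (Fin d)) :=
  aeval fun i => ⟨fun z => z i, (EuclideanSpace.proj (𝕜 := ℂ) i).differentiable⟩

lemma polyFun_apply (P : MvPolynomial (Fin d) ℂ) (z : EuclideanSpace ℂ (Fin d)) :
    (polyFun d P : EuclideanSpace ℂ (Fin d) → ℂ) z = eval (fun i => z i) P := by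
  induction P using MvPolynomial.induction_on with
  | C a => simp [polyFun]
  | add p q hp hq => simp [hp, hq]
  | mul_X p i hp =>
    have hX : (polyFun d (X i) : EuclideanSpace ℂ (Fin d) → ℂ) z = z i := by simp [polyFun]
    simp [hp, hX]

lemma entireOp_X_mul (Q : MvPolynomial (Fin d) ℂ) (i : Fin d)
    (f : entire (EuclideanSpace ℂ (Fin d))) :
    entireOp d Q (polyFun d (X i) * f) =
      polyFun d (X i) * entireOp d Q f + entireOp d (pderiv i Q) f := by
  have hfderiv : ∀ j, dirDeriv (EuclideanSpace.single j 1) (polyFun d (X i)) =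
      algebraMap ℂ _ (EuclideanSpace.single j (1 : ℂ) i) := fun j => by
    ext z
    rw [dirDeriv_apply, polyFun, aeval_X]
    exact DFunLike.congr_fun (EuclideanSpace.proj (𝕜 := ℂ) i).fderiv
      (EuclideanSpace.single j (1 : ℂ))
  exact constCoeffOp_apply_mul (by simp [hfderiv]) (fun j hj => by simp [hfderiv, hj.symm]) Q f

lemma entireOp_mul_apply_zero (P Q : MvPolynomial (Fin d) ℂ)
    (f : entire (EuclideanSpace ℂ (Fin d))) :
    (entireOp d Q (polyFun d P * f) : EuclideanSpace ℂ (Fin d) → ℂ) 0 =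
      (entireOp d (polyOp P Q) f : EuclideanSpace ℂ (Fin d) → ℂ) 0 := by
  induction P using MvPolynomial.induction_on generalizing Q with
  | C a => simp [← algebraMap_eq, ← Algebra.smul_def]
  | add p q hp hq => simp [add_mul, hp, hq]
  | mul_X p i hp =>
    have hvanish : (polyFun d (X i) : EuclideanSpace ℂ (Fin d) → ℂ) 0 = 0 := by
      simp [polyFun_apply]
    rw [polyOp, constCoeffOp_mul_X_apply, ← polyOp, ← hp, mul_comm p, map_mul (polyFun d),
      mul_assoc, entireOp_X_mul]
    simp [hvanish]

end EntireFunctions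

section FischerProduct

variable {σ : Type*}

/-- The multi-index factorial `α! = ∏ i, (α i)!`. -/
def multiFactorial (α : σ →₀ ℕ) : ℕ := α.prod fun _ n => n !

lemma multiFactorial_zero : multiFactorial (0 : σ →₀ ℕ) = 1 := Finsupp.prod_zero_index

lemma multiFactorial_pos (α : σ →₀ ℕ) : 0 < multiFactorial α :=
  Finset.prod_pos fun _ _ => Nat.factorial_pos _

lemma multiFactorial_add_single (α : σ →₀ ℕ) (i : σ) :
    multiFactorial (α + Finsupp.single i 1) = (α i + 1) * multiFactorial α := by
  classical
  have hprod : ∀ γ : σ →₀ ℕ, γ.support ⊆ insert i α.support →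
      multiFactorial γ = (γ i)! * ∏ j ∈ α.support.erase i, (γ j)! := fun γ hγ => by
    rw [multiFactorial, Finsupp.prod_of_support_subset _ hγ _ fun _ _ => Nat.factorial_zero,
      ← Finset.mul_prod_erase _ _ (Finset.mem_insert_self i _), Finset.erase_insert_eq_erase]
  rw [hprod α (Finset.subset_insert _ _), hprod (α + Finsupp.single i 1) ?_]
  · have hrest : ∀ j ∈ α.support.erase i, ((α + Finsupp.single i 1 : σ →₀ ℕ) j)! = (α j)! :=
      fun j hj => by simp [Finsupp.single_eq_of_ne (Finset.ne_of_mem_erase hj)]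
    rw [Finset.prod_congr rfl hrest]
    simp [Nat.factorial_succ, mul_assoc]
  · intro j hj
    rcases eq_or_ne j i with rfl | hji
    · simp
    · simpa [Finsupp.single_eq_of_ne hji, hji] using hj

lemma multiIndex_induction {motive : (σ →₀ ℕ) → Prop} (zero : motive 0)
    (add_single : ∀ α i, motive α → motive (α + Finsupp.single i 1)) (α : σ →₀ ℕ) : motive α := by
  suffices h : ∀ γ, motive γ → motive (γ + α) by simpa using h 0 zero
  induction α using Finsupp.induction_linear with
  | zero => simp
  | add α α' hα hα' => exact fun γ hγ => add_assoc γ α α' ▸ hα' _ (hα _ hγ)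
  | single i n =>
    induction n with
    | zero => simp
    | succ n ih =>
      exact fun γ hγ => by simpa [Finsupp.single_add, add_assoc] using add_single _ i (ih γ hγ)

lemma coeff_polyOp_monomial (α μ : σ →₀ ℕ) (q : MvPolynomial σ ℂ) :
    (multiFactorial μ : ℂ) * coeff μ (polyOp (monomial α 1) q) =
      multiFactorial (μ + α) * coeff (μ + α) q := by
  induction α using multiIndex_induction generalizing q with
  | zero => simp
  | add_single α i ih =>
    rw [monomial_add_single, pow_one, map_mul, Module.End.mul_apply, polyOp_X_apply, ih,
      coeff_pderiv, ← add_assoc, multiFactorial_add_single]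
    push_cast
    ring

/-- The operator `P^*(∂)` on polynomials; it is the adjoint of multiplication by `P` for
`fischerProduct`. -/
def adjointOp : MvPolynomial σ ℂ →+* Module.End ℂ (MvPolynomial σ ℂ) :=
  (polyOp : MvPolynomial σ ℂ →ₐ[ℂ] _).toRingHom.comp (map (starRingEnd ℂ))

lemma adjointOp_eq_polyOp (P : MvPolynomial σ ℂ) :
    adjointOp P = polyOp (map (starRingEnd ℂ) P) := rfl

lemma adjointOp_X_apply (i : σ) (q : MvPolynomial σ ℂ) : adjointOp (X i) q = pderiv i q := by
  rw [adjointOp_eq_polyOp, map_X, polyOp_X_apply]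

lemma adjointOp_monomial (α : σ →₀ ℕ) (c : ℂ) :
    adjointOp (monomial α c) = conj c • polyOp (monomial α 1) := by
  rw [adjointOp_eq_polyOp, map_monomial, ← map_smul, smul_monomial, smul_eq_mul, mul_one]

lemma adjointOp_C (c : ℂ) : adjointOp (C c : MvPolynomial σ ℂ) = algebraMap ℂ _ (conj c) := by
  rw [adjointOp_eq_polyOp, map_C, ← algebraMap_eq, AlgHom.commutes]

/-- The Fischer inner product `⟨p, q⟩ = (p^*(∂) q)(0) = ∑ α! conj(p_α) q_α` of two polynomials. -/
def fischerProduct (p q : MvPolynomial σ ℂ) : ℂ :=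
  coeff 0 (adjointOp p q)

lemma fischerProduct_monomial_left (α : σ →₀ ℕ) (c : ℂ) (q : MvPolynomial σ ℂ) :
    fischerProduct (monomial α c) q = multiFactorial α * (conj c * coeff α q) := by
  have hcoeff : coeff 0 (polyOp (monomial α 1) q) = multiFactorial α * coeff α q := by
    simpa [multiFactorial_zero] using coeff_polyOp_monomial α 0 q
  rw [fischerProduct, adjointOp_monomial, LinearMap.smul_apply, coeff_smul, hcoeff, smul_eq_mul,
    mul_left_comm]

lemma fischerProduct_eq_sum {p q : MvPolynomial σ ℂ} {s : Finset (σ →₀ ℕ)} (hs : p.support ⊆ s) :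
    fischerProduct p q = ∑ α ∈ s, multiFactorial α * (conj (coeff α p) * coeff α q) := by
  have hsupport : fischerProduct p q =
      ∑ α ∈ p.support, multiFactorial α * (conj (coeff α p) * coeff α q) := by
    conv_lhs => rw [p.as_sum, fischerProduct, map_sum, LinearMap.sum_apply, coeff_sum]
    exact Finset.sum_congr rfl fun α _ => fischerProduct_monomial_left α _ q
  rw [hsupport]
  exact Finset.sum_subset hs fun α _ hα => by simp [notMem_support_iff.1 hα]

lemma fischerProduct_self (p : MvPolynomial σ ℂ) :
    fischerProduct p p =
      ((∑ α ∈ p.support, multiFactorial α * ‖coeff α p‖ ^ 2 : ℝ) : ℂ) := by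
  rw [fischerProduct_eq_sum subset_rfl]
  push_cast
  simp only [Complex.conj_mul']

/-- The Fischer inner product makes the polynomials an inner product space. -/
abbrev fischerCore : InnerProductSpace.Core ℂ (MvPolynomial σ ℂ) where
  inner := fischerProduct
  conj_inner_symm p q := by
    classical
    rw [fischerProduct_eq_sum (Finset.subset_union_right (s₁ := p.support)),
      fischerProduct_eq_sum (Finset.subset_union_left (s₂ := q.support)), map_sum]
    exact Finset.sum_congr rfl fun α _ => by simp [mul_comm]
  re_inner_nonneg p := by
    rw [fischerProduct_self]
    simp only [RCLike.re_to_complex, Complex.ofReal_re]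
    positivity
  add_left p q r := by simp [fischerProduct]
  smul_left p q r := by
    simp [fischerProduct, smul_eq_C_mul, adjointOp_C]
  definite p hp := by
    rw [fischerProduct_self, Complex.ofReal_eq_zero,
      Finset.sum_eq_zero_iff_of_nonneg fun _ _ => by positivity] at hp
    refine support_eq_empty.1 (Finset.eq_empty_of_forall_notMem fun α hα => ?_)
    simpa [(multiFactorial_pos α).ne', mem_support_iff.1 hα] using hp α hα

end FischerProduct

local instance {σ : Type*} : NormedAddCommGroup (MvPolynomial σ ℂ) :=
  fischerCore.toNormedAddCommGroup

local instance {σ : Type*} : InnerProductSpace ℂ (MvPolynomial σ ℂ) :=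
  InnerProductSpace.ofCore fischerCore.toCore

section FischerNorm

variable {σ : Type*}

lemma inner_eq_fischerProduct (p q : MvPolynomial σ ℂ) : inner ℂ p q = fischerProduct p q := rfl

lemma norm_sq_eq_sum {p : MvPolynomial σ ℂ} :
    ‖p‖ ^ 2 = ∑ α ∈ p.support, multiFactorial α * ‖coeff α p‖ ^ 2 := by
  rw [← Complex.ofReal_inj, ← fischerProduct_self, ← inner_eq_fischerProduct,
    inner_self_eq_norm_sq_to_K]
  simp

lemma inner_mul_left_eq (a p q : MvPolynomial σ ℂ) :
    inner ℂ (a * p) q = inner ℂ p (adjointOp a q) := by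
  rw [inner_eq_fischerProduct, inner_eq_fischerProduct, fischerProduct, fischerProduct, mul_comm,
    map_mul, Module.End.mul_apply]

lemma inner_mul_right_eq (a p q : MvPolynomial σ ℂ) :
    inner ℂ p (a * q) = inner ℂ (adjointOp a p) q := by
  rw [← inner_conj_symm, inner_mul_left_eq, inner_conj_symm]

lemma norm_X_mul_le {g : MvPolynomial σ ℂ} {n : ℕ} (hg : g.IsHomogeneous n) (i : σ) :
    ‖X i * g‖ ≤ √(n + 1) * ‖g‖ := by
  refine le_of_sq_le_sq ?_ (by positivity)
  rw [mul_pow, Real.sq_sqrt (by positivity), norm_sq_eq_sum, norm_sq_eq_sum, support_X_mul,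
    Finset.sum_map, Finset.mul_sum]
  refine Finset.sum_le_sum fun α hα => ?_
  have hα_le : α i ≤ n := (Finsupp.le_degree i α).trans_eq (hg.degree_eq_sum_deg_support hα).symm
  rw [addLeftEmbedding_apply, coeff_X_mul, add_comm, multiFactorial_add_single, Nat.cast_mul,
    mul_assoc]
  gcongr
  exact_mod_cast Nat.succ_le_succ hα_le

lemma norm_monomial_mul_le {g : MvPolynomial σ ℂ} {n : ℕ} (hg : g.IsHomogeneous n) (α : σ →₀ ℕ) :
    ‖monomial α 1 * g‖ ≤ √(n + α.degree) ^ α.degree * ‖g‖ := by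
  induction α using multiIndex_induction with
  | zero => simp
  | add_single α i ih =>
    have hhom : (monomial α 1 * g).IsHomogeneous (α.degree + n) :=
      (isHomogeneous_monomial 1 rfl).mul hg
    have hdegree : (α + Finsupp.single i 1).degree = α.degree + 1 := by simp
    rw [hdegree]
    have hmono : √(n + α.degree) ≤ √(n + (α.degree + 1 : ℕ)) := by gcongr; simp
    calc ‖monomial (α + Finsupp.single i 1) 1 * g‖ = ‖X i * (monomial α 1 * g)‖ := by
          rw [monomial_add_single, pow_one, mul_comm (monomial α 1), mul_assoc]
      _ ≤ √((α.degree + n : ℕ) + 1) * (√(n + α.degree) ^ α.degree * ‖g‖) :=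
          (norm_X_mul_le hhom i).trans (by gcongr)
      _ = √(n + (α.degree + 1 : ℕ)) * (√(n + α.degree) ^ α.degree * ‖g‖) := by
          congr 2
          push_cast
          ring
      _ ≤ √(n + (α.degree + 1 : ℕ)) * (√(n + (α.degree + 1 : ℕ)) ^ α.degree * ‖g‖) := by gcongr
      _ = √(n + (α.degree + 1 : ℕ)) ^ (α.degree + 1) * ‖g‖ := by rw [pow_succ', mul_assoc]

lemma norm_mul_le_of_isHomogeneous {Q g : MvPolynomial σ ℂ} {j n : ℕ} (hQ : Q.IsHomogeneous j)
    (hg : g.IsHomogeneous n) :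
    ‖Q * g‖ ≤ (∑ α ∈ Q.support, ‖coeff α Q‖) * √(n + j) ^ j * ‖g‖ := by
  have hsum : Q * g = ∑ α ∈ Q.support, coeff α Q • (monomial α 1 * g) := by
    conv_lhs => rw [Q.as_sum, Finset.sum_mul]
    simp only [← smul_mul_assoc, smul_monomial, smul_eq_mul, mul_one]
  rw [hsum, mul_assoc, Finset.sum_mul]
  refine norm_sum_le_of_le _ fun α hα => ?_
  have hdegree : α.degree = j := (hQ.degree_eq_sum_deg_support hα).symm
  rw [norm_smul, ← hdegree]
  gcongr
  exact norm_monomial_mul_le hg α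

end FischerNorm

section Bombieri

variable {σ : Type*}

lemma exists_finset_polyOp_monomial_eq_zero (Q : MvPolynomial σ ℂ) :
    ∃ s : Finset (σ →₀ ℕ), Q.support ⊆ s ∧ ∀ γ ∉ s, polyOp (monomial γ 1) Q = 0 := by
  classical
  refine ⟨Q.support.biUnion Finset.Iic,
    fun γ hγ => Finset.mem_biUnion.2 ⟨γ, hγ, Finset.mem_Iic.2 le_rfl⟩, fun γ hγ => ?_⟩
  ext μ
  have hμ : μ + γ ∉ Q.support := fun h =>
    hγ (Finset.mem_biUnion.2 ⟨μ + γ, h, Finset.mem_Iic.2 le_add_self⟩)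
  simpa [notMem_support_iff.1 hμ, (multiFactorial_pos μ).ne'] using coeff_polyOp_monomial γ μ Q

lemma polyOp_monomial_of_le_degree {Q : MvPolynomial σ ℂ} {k : ℕ} (hQ : Q.IsHomogeneous k)
    {γ : σ →₀ ℕ} (hγ : k ≤ γ.degree) :
    polyOp (monomial γ 1) Q = C (multiFactorial γ * coeff γ Q) := by
  classical
  ext μ
  have hcoeff := coeff_polyOp_monomial γ μ Q
  rw [coeff_C]
  split_ifs with hμ
  · simpa [← hμ, multiFactorial_zero] using hcoeff
  · have hμ_pos : μ.degree ≠ 0 := fun h => hμ ((Finsupp.degree_eq_zero_iff μ).1 h).symm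
    have hdegree : (μ + γ).degree ≠ k := by
      rw [map_add]
      lia
    simpa [hQ.coeff_eq_zero hdegree, (multiFactorial_pos μ).ne'] using hcoeff

lemma polyOp_monomial_add_single (γ : σ →₀ ℕ) (i : σ) (Q : MvPolynomial σ ℂ) :
    polyOp (monomial (γ + Finsupp.single i 1) 1) Q = polyOp (monomial γ 1) (pderiv i Q) := by
  rw [monomial_add_single, pow_one, map_mul, Module.End.mul_apply, polyOp_X_apply]

lemma inner_C_mul_mul_eq_sum (a : ℂ) (f B g : MvPolynomial σ ℂ) {s : Finset (σ →₀ ℕ)}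
    (hs : ∀ γ ∉ s, polyOp (monomial γ 1) B = 0) :
    inner ℂ (C a * f) (B * g) =
      ∑ γ ∈ s, (multiFactorial γ : ℂ)⁻¹ * inner ℂ (adjointOp (polyOp (monomial γ 1) B) f)
        (adjointOp (polyOp (monomial γ 1) (C a)) g) := by
  have hC : ∀ γ ≠ 0, polyOp (monomial γ 1) (C a : MvPolynomial σ ℂ) = 0 := fun γ hγ => by
    rw [polyOp_monomial_of_le_degree (isHomogeneous_C σ a) (Nat.zero_le _),
      coeff_C_of_ne_zero hγ, mul_zero, C_0]
  have hzero : (0 : σ →₀ ℕ) ∉ s → B = 0 := fun h => by simpa using hs 0 h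
  rw [Finset.sum_eq_single 0 (fun γ _ hγ => by simp [hC γ hγ]) fun h => by simp [hzero h],
    inner_mul_right_eq, ← smul_eq_C_mul, map_smul, inner_smul_left]
  simp [multiFactorial_zero, adjointOp_C]

lemma sum_preimage_add_single (s : Finset (σ →₀ ℕ)) (i : σ)
    (u : (σ →₀ ℕ) → MvPolynomial σ ℂ) (A g : MvPolynomial σ ℂ) :
    ∑ γ ∈ s.preimage (· + Finsupp.single i 1) (add_left_injective _).injOn,
        (multiFactorial γ : ℂ)⁻¹ *
          inner ℂ (u (γ + Finsupp.single i 1)) (adjointOp (polyOp (monomial γ 1) A) g) =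
      ∑ γ ∈ s, (multiFactorial γ : ℂ)⁻¹ *
        inner ℂ (u γ) (adjointOp (polyOp (pderiv i (monomial γ 1)) A) g) := by
  rw [← Finset.sum_preimage _ s (add_left_injective (Finsupp.single i 1)).injOn]
  · refine Finset.sum_congr rfl fun γ _ => ?_
    have hpderiv : pderiv i (monomial (γ + Finsupp.single i 1) (1 : ℂ)) =
        (γ i + 1) • monomial γ 1 := by
      simp [pderiv_monomial, smul_monomial]
    have hpos : (multiFactorial γ : ℂ) ≠ 0 := by exact_mod_cast (multiFactorial_pos γ).ne'
    rw [hpderiv, multiFactorial_add_single, map_nsmul,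
      LinearMap.smul_apply, map_nsmul, LinearMap.smul_apply, ← Nat.cast_smul_eq_nsmul ℂ,
      inner_smul_right]
    push_cast
    field_simp
  · intro γ _ hγ
    have hγi : γ i = 0 := by
      by_contra h
      exact hγ ⟨γ - Finsupp.single i 1, tsub_add_cancel_of_le (by
        simpa using Nat.one_le_iff_ne_zero.2 h)⟩
    simp [pderiv_monomial, hγi]

/-- The commutation relation `[∂_i, x_i] = 1` gives a normal ordering of `⟨A f, B g⟩` in which all
differentiations act on `f` and `g`. -/
lemma inner_mul_mul_eq_sum (A f B g : MvPolynomial σ ℂ) {s : Finset (σ →₀ ℕ)}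
    (hs : ∀ γ ∉ s, polyOp (monomial γ 1) B = 0) :
    inner ℂ (A * f) (B * g) =
      ∑ γ ∈ s, (multiFactorial γ : ℂ)⁻¹ * inner ℂ (adjointOp (polyOp (monomial γ 1) B) f)
        (adjointOp (polyOp (monomial γ 1) A) g) := by
  classical
  induction A using MvPolynomial.induction_on generalizing f B g s with
  | C a => exact inner_C_mul_mul_eq_sum a f B g hs
  | add p q hp hq => simp only [add_mul, inner_add_left, hp f B g hs, hq f B g hs, map_add,
      LinearMap.add_apply, inner_add_right, mul_add, Finset.sum_add_distrib]
  | mul_X A i hA =>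
    have hleibniz : pderiv i (B * g) = pderiv i B * g + B * pderiv i g := by
      rw [Derivation.leibniz, smul_eq_mul, smul_eq_mul, mul_comm g, add_comm]
    have hs' : ∀ γ ∉ s.preimage (· + Finsupp.single i 1) (add_left_injective _).injOn,
        polyOp (monomial γ 1) (pderiv i B) = 0 := fun γ hγ =>
      polyOp_monomial_add_single γ i B ▸ hs _ (by simpa using hγ)
    rw [mul_right_comm, mul_comm, inner_mul_left_eq, adjointOp_X_apply, hleibniz, inner_add_right,
      hA f _ _ hs', hA f _ _ hs]
    simp only [← polyOp_monomial_add_single]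
    rw [sum_preimage_add_single s i (fun γ => adjointOp (polyOp (monomial γ 1) B) f) A g,
      ← Finset.sum_add_distrib]
    refine Finset.sum_congr rfl fun γ _ => ?_
    rw [mul_comm A, polyOp_X_mul, map_add, LinearMap.add_apply, inner_add_right, mul_add, add_comm,
      mul_comm (X i), map_mul, Module.End.mul_apply, adjointOp_X_apply]

lemma norm_mul_norm_le_of_isHomogeneous {Q : MvPolynomial σ ℂ} {k : ℕ} (hQ : Q.IsHomogeneous k)
    (f : MvPolynomial σ ℂ) : ‖Q‖ * ‖f‖ ≤ ‖Q * f‖ := by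
  obtain ⟨s, hsupport, hs⟩ := exists_finset_polyOp_monomial_eq_zero Q
  have hsum : ‖Q * f‖ ^ 2 =
      ∑ γ ∈ s, (multiFactorial γ : ℝ)⁻¹ * ‖adjointOp (polyOp (monomial γ 1) Q) f‖ ^ 2 := by
    have hinner := inner_mul_mul_eq_sum Q f Q f hs
    simp only [inner_self_eq_norm_sq_to_K] at hinner
    rw [← Complex.ofReal_inj]
    push_cast
    exact hinner
  have hterm : ∀ γ ∈ Q.support, multiFactorial γ * ‖coeff γ Q‖ ^ 2 * ‖f‖ ^ 2 =
      (multiFactorial γ : ℝ)⁻¹ * ‖adjointOp (polyOp (monomial γ 1) Q) f‖ ^ 2 := fun γ hγ => by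
    have hpos : (multiFactorial γ : ℝ) ≠ 0 := by exact_mod_cast (multiFactorial_pos γ).ne'
    rw [polyOp_monomial_of_le_degree hQ (hQ.degree_eq_sum_deg_support hγ).le, adjointOp_C,
      Module.algebraMap_end_apply, norm_smul, RCLike.norm_conj, norm_mul, Complex.norm_natCast]
    field_simp
  refine le_of_sq_le_sq ?_ (norm_nonneg _)
  rw [mul_pow, norm_sq_eq_sum, Finset.sum_mul, Finset.sum_congr rfl hterm, hsum]
  exact Finset.sum_le_sum_of_subset_of_nonneg hsupport fun _ _ _ => by positivity

end Bombieri

section TaylorParts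

lemma norm_le_norm_of_inner_add_eq_zero {𝕜 E : Type*} [RCLike 𝕜] [NormedAddCommGroup E]
    [InnerProductSpace 𝕜 E] {u w : E} (h : inner 𝕜 u (u + w) = 0) : ‖u‖ ≤ ‖w‖ := by
  have hpythagoras := norm_add_sq_eq_norm_sq_add_norm_sq_of_inner_eq_zero (𝕜 := 𝕜) (-u) (u + w)
    (by rw [inner_neg_left, h, neg_zero])
  rw [neg_add_cancel_left, norm_neg] at hpythagoras
  nlinarith [norm_nonneg u, norm_nonneg w, mul_self_nonneg ‖u + w‖]

lemma adjointOp_isHomogeneous {σ : Type*} {A p : MvPolynomial σ ℂ} {j n : ℕ}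
    (hA : A.IsHomogeneous j) (hp : p.IsHomogeneous (n + j)) : (adjointOp A p).IsHomogeneous n := by
  rw [A.as_sum, map_sum, LinearMap.sum_apply]
  refine IsHomogeneous.sum _ _ _ fun α hα μ hμ => ?_
  rw [adjointOp_monomial, LinearMap.smul_apply, coeff_smul] at hμ
  have hcoeff : coeff (μ + α) p ≠ 0 := fun h => by
    have hzero := coeff_polyOp_monomial α μ p
    rw [h, mul_zero, mul_eq_zero] at hzero
    exact hμ (by simp [hzero.resolve_left (by exact_mod_cast (multiFactorial_pos μ).ne')])
  have hdegree := hp hcoeff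
  rw [map_add, hA (mem_support_iff.1 hα)] at hdegree
  exact Nat.add_right_cancel hdegree

lemma map_conj_map_conj {σ : Type*} (p : MvPolynomial σ ℂ) :
    map (starRingEnd ℂ) (map (starRingEnd ℂ) p) = p := by
  rw [map_map,
    show (starRingEnd ℂ).comp (starRingEnd ℂ) = RingHom.id ℂ from RingHom.ext Complex.conj_conj,
    map_id]

variable {d : ℕ}

/-- The homogeneous part of degree `n` of the Taylor expansion of `f` at `0`. -/
def taylorPart (f : entire (EuclideanSpace ℂ (Fin d))) (n : ℕ) : MvPolynomial (Fin d) ℂ :=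
  ∑ α ∈ Finset.finsuppAntidiag Finset.univ n,
    monomial α ((entireOp d (monomial α 1) f : EuclideanSpace ℂ (Fin d) → ℂ) 0 / multiFactorial α)

lemma mem_finsuppAntidiag_univ {α : Fin d →₀ ℕ} {n : ℕ} :
    α ∈ Finset.finsuppAntidiag Finset.univ n ↔ α.degree = n := by
  simp [Finset.mem_finsuppAntidiag, Finsupp.degree_eq_sum]

variable (f : entire (EuclideanSpace ℂ (Fin d)))

lemma taylorPart_isHomogeneous (n : ℕ) : (taylorPart f n).IsHomogeneous n :=
  IsHomogeneous.sum _ _ _ fun _ hα => isHomogeneous_monomial _ (mem_finsuppAntidiag_univ.1 hα)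

lemma coeff_taylorPart (α : Fin d →₀ ℕ) :
    coeff α (taylorPart f α.degree) =
      (entireOp d (monomial α 1) f : EuclideanSpace ℂ (Fin d) → ℂ) 0 / multiFactorial α := by
  classical
  rw [taylorPart, coeff_sum]
  simp only [coeff_monomial]
  rw [Finset.sum_ite_eq', if_pos (mem_finsuppAntidiag_univ.2 rfl)]

lemma inner_taylorPart {p : MvPolynomial (Fin d) ℂ} {n : ℕ} (hp : p.IsHomogeneous n) :
    inner ℂ p (taylorPart f n) =
      (entireOp d (map (starRingEnd ℂ) p) f : EuclideanSpace ℂ (Fin d) → ℂ) 0 := by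
  rw [inner_eq_fischerProduct, fischerProduct_eq_sum subset_rfl]
  conv_rhs => rw [p.as_sum, map_sum, map_sum]
  rw [LinearMap.sum_apply, AddSubmonoidClass.coe_finsetSum, Finset.sum_apply]
  refine Finset.sum_congr rfl fun α hα => ?_
  have hpos : (multiFactorial α : ℂ) ≠ 0 := by exact_mod_cast (multiFactorial_pos α).ne'
  have hmonomial : map (starRingEnd ℂ) (monomial α (coeff α p)) =
      conj (coeff α p) • monomial α 1 := by simp [smul_monomial]
  obtain rfl : α.degree = n := (hp.degree_eq_sum_deg_support hα).symm
  rw [coeff_taylorPart, hmonomial, map_smul]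
  simp only [LinearMap.smul_apply, SetLike.val_smul, Pi.smul_apply, smul_eq_mul]
  field_simp

lemma inner_mul_taylorPart {A p : MvPolynomial (Fin d) ℂ} {j n : ℕ} (hA : A.IsHomogeneous j)
    (hp : p.IsHomogeneous (n + j)) :
    inner ℂ p (A * taylorPart f n) =
      (entireOp d (map (starRingEnd ℂ) p) (polyFun d A * f) : EuclideanSpace ℂ (Fin d) → ℂ) 0 := by
  have hmap : map (starRingEnd ℂ) (adjointOp A p) = polyOp A (map (starRingEnd ℂ) p) := by
    rw [adjointOp_eq_polyOp, map_polyOp, map_conj_map_conj]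
  rw [inner_mul_right_eq, inner_taylorPart f (adjointOp_isHomogeneous hA hp),
    entireOp_mul_apply_zero, hmap]

/-- The equation says that `P_k f_m` is orthogonal to the part of degree `m + k` of `P f`, one of
whose summands is `P_k f_m` itself. -/
lemma norm_mul_taylorPart_le {k β : ℕ} (hβ : β < k) {P : ℕ → MvPolynomial (Fin d) ℂ}
    (hP : ∀ j, (P j).IsHomogeneous j)
    (hf : entireOp d (map (starRingEnd ℂ) (P k))
      (polyFun d (∑ j ∈ Finset.range (β + 1), P j + P k) * f) = 0) (m : ℕ) :
    ‖P k * taylorPart f m‖ ≤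
      ‖∑ j ∈ Finset.range (β + 1), P j * taylorPart f (m + k - j)‖ := by
  let u := P k * taylorPart f m
  let w := ∑ j ∈ Finset.range (β + 1), P j * taylorPart f (m + k - j)
  have hu : u.IsHomogeneous (m + k) := add_comm k m ▸ (hP k).mul (taylorPart_isHomogeneous f m)
  have horthogonal : inner ℂ u w + inner ℂ u u = 0 := by
    have hconj : map (starRingEnd ℂ) u =
        map (starRingEnd ℂ) (taylorPart f m) * map (starRingEnd ℂ) (P k) := by
      rw [← map_mul, mul_comm]
    have hzero : (entireOp d (map (starRingEnd ℂ) u)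
        (polyFun d (∑ j ∈ Finset.range (β + 1), P j + P k) * f) :
          EuclideanSpace ℂ (Fin d) → ℂ) 0 = 0 := by
      rw [hconj, map_mul (entireOp d), Module.End.mul_apply, hf, map_zero]
      rfl
    rw [inner_mul_taylorPart f (hP k) hu, inner_sum, ← hzero, map_add,
      map_sum, add_mul, Finset.sum_mul, map_add, map_sum]
    simp only [AddSubmonoidClass.coe_finsetSum, Finset.sum_apply, Subalgebra.coe_add, Pi.add_apply]
    congr 1
    refine Finset.sum_congr rfl fun j hj => ?_
    have hj' : m + k - j + j = m + k := by have := Finset.mem_range.1 hj; lia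
    exact inner_mul_taylorPart f (hP j) (by rwa [hj'])
  exact norm_le_norm_of_inner_add_eq_zero (𝕜 := ℂ) (by rwa [inner_add_right, add_comm])

lemma norm_mul_norm_taylorPart_le {k β : ℕ} (hβ : β < k) {P : ℕ → MvPolynomial (Fin d) ℂ}
    (hP : ∀ j, (P j).IsHomogeneous j)
    (hf : entireOp d (map (starRingEnd ℂ) (P k))
      (polyFun d (∑ j ∈ Finset.range (β + 1), P j + P k) * f) = 0) (m : ℕ) :
    ‖P k‖ * ‖taylorPart f m‖ ≤ ∑ j ∈ Finset.range (β + 1),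
      (∑ α ∈ (P j).support, ‖coeff α (P j)‖) * √(m + k) ^ j * ‖taylorPart f (m + k - j)‖ := by
  refine (norm_mul_norm_le_of_isHomogeneous (hP k) _).trans
    ((norm_mul_taylorPart_le f hβ hP hf m).trans (norm_sum_le_of_le _ fun j hj => ?_))
  have hj_le : j ≤ m + k := by have := Finset.mem_range.1 hj; lia
  have hnorm := norm_mul_le_of_isHomogeneous (hP j) (taylorPart_isHomogeneous f (m + k - j))
  rwa [Nat.cast_sub hj_le, sub_add_cancel, Nat.cast_add] at hnorm

end TaylorParts

section Growth

lemma sum_norm_pderiv_sq {σ : Type*} [Fintype σ] {p : MvPolynomial σ ℂ} {n : ℕ}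
    (hp : p.IsHomogeneous n) : ∑ i, ‖pderiv i p‖ ^ 2 = n * ‖p‖ ^ 2 := by
  have hinner : ∑ i, inner ℂ (pderiv i p) (pderiv i p) = (n : ℂ) * inner ℂ p p := by
    rw [← inner_smul_right, Nat.cast_smul_eq_nsmul, ← hp.sum_X_mul_pderiv, inner_sum]
    simp only [inner_mul_right_eq, adjointOp_X_apply]
  simp only [inner_self_eq_norm_sq_to_K] at hinner
  rw [← Complex.ofReal_inj]
  push_cast
  exact hinner

lemma norm_C_eq {σ : Type*} (a : ℂ) : ‖(C a : MvPolynomial σ ℂ)‖ = ‖a‖ := by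
  have hsq : ((‖(C a : MvPolynomial σ ℂ)‖ ^ 2 : ℝ) : ℂ) = ((‖a‖ ^ 2 : ℝ) : ℂ) := by
    push_cast
    refine (inner_self_eq_norm_sq_to_K (𝕜 := ℂ) (C a : MvPolynomial σ ℂ)).symm.trans ?_
    rw [inner_eq_fischerProduct, C_apply, fischerProduct_monomial_left]
    simp [multiFactorial_zero, Complex.conj_mul']
  exact (sq_eq_sq₀ (norm_nonneg _) (norm_nonneg _)).1 (Complex.ofReal_injective hsq)

variable {d : ℕ}

lemma taylorPart_zero (f : entire (EuclideanSpace ℂ (Fin d))) :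
    taylorPart f 0 = C ((f : EuclideanSpace ℂ (Fin d) → ℂ) 0) := by
  simp [taylorPart, multiFactorial_zero]

lemma taylorPart_entireOp_X (f : entire (EuclideanSpace ℂ (Fin d))) (i : Fin d) (n : ℕ) :
    taylorPart (entireOp d (X i) f) n = pderiv i (taylorPart f (n + 1)) := by
  ext α
  rw [coeff_pderiv]
  by_cases hα : α.degree = n
  · subst hα
    have hdegree : α.degree + 1 = (α + Finsupp.single i 1).degree := by simp
    have hα_pos : (α i + 1 : ℂ) ≠ 0 := by exact_mod_cast (α i).succ_ne_zero
    rw [coeff_taylorPart, hdegree, coeff_taylorPart, multiFactorial_add_single,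
      monomial_add_single, pow_one, map_mul (entireOp d), Module.End.mul_apply]
    push_cast
    field_simp
  · rw [(taylorPart_isHomogeneous _ n).coeff_eq_zero hα,
      (taylorPart_isHomogeneous f _).coeff_eq_zero (by simpa using hα), zero_mul]

/-- By Euler's identity `f_{n+1}` is controlled by its partial derivatives, and each of the `n`
differentiations costs one Cauchy estimate on a disc of radius `δ`. -/
lemma norm_taylorPart_sq_le {δ : ℝ} (hδ : 0 < δ) (n : ℕ) {K : ℝ}
    {f : entire (EuclideanSpace ℂ (Fin d))}
    (hK : ∀ z, ‖z‖ ≤ n * δ → ‖(f : EuclideanSpace ℂ (Fin d) → ℂ) z‖ ≤ K) :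
    ‖taylorPart f n‖ ^ 2 ≤ d ^ n / n ! * (K / δ ^ n) ^ 2 := by
  induction n generalizing f K with
  | zero =>
    rw [taylorPart_zero, norm_C_eq]
    simpa using pow_le_pow_left₀ (norm_nonneg _) (hK 0 (by simp)) 2
  | succ n ih =>
    have hderiv : ∀ i, ‖pderiv i (taylorPart f (n + 1))‖ ^ 2 ≤
        d ^ n / n ! * (K / δ / δ ^ n) ^ 2 := fun i => by
      rw [← taylorPart_entireOp_X]
      refine ih fun z hz => ?_
      rw [coe_entireOp_X]
      refine norm_fderiv_apply_le f.2 z _ hδ fun w hw => hK w ?_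
      rw [PiLp.norm_single, norm_one, mul_one] at hw
      calc ‖w‖ ≤ ‖w - z‖ + ‖z‖ := norm_le_norm_sub_add w z
        _ ≤ δ + n * δ := add_le_add hw hz
        _ = (n + 1 : ℕ) * δ := by push_cast; ring
    have hsum : (n + 1 : ℕ) * ‖taylorPart f (n + 1)‖ ^ 2 ≤
        d * (d ^ n / n ! * (K / δ / δ ^ n) ^ 2) := by
      rw [← sum_norm_pderiv_sq (taylorPart_isHomogeneous f (n + 1))]
      simpa using Finset.sum_le_sum fun i (_ : i ∈ Finset.univ) => hderiv i
    refine le_of_mul_le_mul_left (hsum.trans_eq ?_) (by positivity : (0 : ℝ) < (n + 1 : ℕ))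
    rw [Nat.factorial_succ]
    push_cast
    field_simp
    ring

lemma norm_taylorPart_le {f : entire (EuclideanSpace ℂ (Fin d))} {C s : ℝ} (hs : 0 < s)
    (hf : ∀ z, ‖(f : EuclideanSpace ℂ (Fin d) → ℂ) z‖ ≤ C * Real.exp (‖z‖ ^ s)) {n : ℕ}
    (hn : 0 < n) :
    ‖taylorPart f n‖ ≤ C * √(n !) * (√d * Real.exp 2 / n ^ (1 / s)) ^ n := by
  have hn' : (0 : ℝ) < n := by exact_mod_cast hn
  have hC : 0 ≤ C := nonneg_of_mul_nonneg_left ((norm_nonneg _).trans (hf 0)) (Real.exp_pos _)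
  -- The radius `n ^ (1 / s)` is the one at which the growth bound equals `C * exp n`.
  have hsq : ‖taylorPart f n‖ ^ 2 ≤
      d ^ n / n ! * (C * Real.exp n / (n ^ (1 / s) / n) ^ n) ^ 2 := by
    refine norm_taylorPart_sq_le (by positivity) n fun z hz => (hf z).trans ?_
    gcongr
    rw [mul_div_cancel₀ _ hn'.ne'] at hz
    calc ‖z‖ ^ s ≤ ((n : ℝ) ^ (1 / s)) ^ s := by gcongr
      _ = n := by rw [one_div, Real.rpow_inv_rpow hn'.le hs.ne']
  have hfactorial : (n : ℝ) ^ n ≤ Real.exp n * n ! := by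
    have hexp := Real.pow_div_factorial_le_exp (n : ℝ) hn'.le n
    rwa [div_le_iff₀ (by positivity)] at hexp
  refine le_of_sq_le_sq (hsq.trans ?_) (by positivity)
  calc (d : ℝ) ^ n / n ! * (C * Real.exp n / (n ^ (1 / s) / n) ^ n) ^ 2
      = d ^ n / n ! * (C * Real.exp n / (n ^ (1 / s)) ^ n) ^ 2 * (n ^ n) ^ 2 := by
        rw [div_pow ((n : ℝ) ^ (1 / s))]
        field_simp
    _ ≤ d ^ n / n ! * (C * Real.exp n / (n ^ (1 / s)) ^ n) ^ 2 * (Real.exp n * n !) ^ 2 := by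
        gcongr
    _ = (C * √(n !) * (√d * Real.exp 2 / n ^ (1 / s)) ^ n) ^ 2 := by
        have hsqrt : (√d ^ n) ^ 2 = (d : ℝ) ^ n := by
          rw [← pow_mul, mul_comm, pow_mul, Real.sq_sqrt (Nat.cast_nonneg d)]
        have hexp : Real.exp 2 ^ n = Real.exp n ^ 2 := by
          rw [← Real.exp_nat_mul, ← Real.exp_nat_mul]
          push_cast
          ring_nf
        have hsqrt_factorial : √(n ! : ℝ) ^ 2 = n ! := Real.sq_sqrt (Nat.cast_nonneg _)
        simp only [div_pow, mul_pow, hsqrt, hexp, hsqrt_factorial]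
        field_simp

open Filter Topology in
lemma tendsto_pow_mul_factorial_rpow_mul_norm_taylorPart
    {f : entire (EuclideanSpace ℂ (Fin d))} {C s g A : ℝ} (hs : 0 < s)
    (hf : ∀ z, ‖(f : EuclideanSpace ℂ (Fin d) → ℂ) z‖ ≤ C * Real.exp (‖z‖ ^ s)) (hg : 0 ≤ g)
    (hgs : g + 1 / 2 < 1 / s) (hA : 0 ≤ A) :
    Tendsto (fun n : ℕ => A ^ n * ((n ! : ℝ) ^ g * ‖taylorPart f n‖)) atTop (𝓝 0) := by
  set B : ℝ := A * (√d * Real.exp 2)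
  set ε : ℝ := 1 / s - (g + 1 / 2)
  have hC : 0 ≤ C := nonneg_of_mul_nonneg_left ((norm_nonneg _).trans (hf 0)) (Real.exp_pos _)
  have hbase : Tendsto (fun n : ℕ => B * (n : ℝ) ^ (-ε)) atTop (𝓝 0) := by
    have hrpow := (tendsto_rpow_neg_atTop (sub_pos.2 hgs)).comp tendsto_natCast_atTop_atTop
    simpa only [mul_zero] using! hrpow.const_mul B
  have hpow : Tendsto (fun n : ℕ => C * (1 / 2 : ℝ) ^ n) atTop (𝓝 0) := by
    have hhalf : Tendsto (fun n : ℕ => (1 / 2 : ℝ) ^ n) atTop (𝓝 0) :=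
      tendsto_pow_atTop_nhds_zero_of_lt_one (by norm_num) (by norm_num)
    simpa only [mul_zero] using hhalf.const_mul C
  refine squeeze_zero' (Eventually.of_forall fun n => by positivity) ?_ hpow
  filter_upwards [hbase.eventually_le_const (by norm_num : (0 : ℝ) < 1 / 2),
    eventually_gt_atTop 0] with n hn_base hn
  have hn' : (0 : ℝ) < n := by exact_mod_cast hn
  have hfactorial : (n ! : ℝ) ^ g * √(n !) ≤ ((n : ℝ) ^ (g + 1 / 2)) ^ n := by
    rw [Real.sqrt_eq_rpow, ← Real.rpow_add (by positivity), ← Real.rpow_mul_natCast hn'.le,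
      mul_comm _ (n : ℝ), Real.rpow_natCast_mul hn'.le]
    gcongr
    exact_mod_cast Nat.factorial_le_pow n
  calc A ^ n * ((n ! : ℝ) ^ g * ‖taylorPart f n‖)
      ≤ A ^ n * ((n ! : ℝ) ^ g * (C * √(n !) * (√d * Real.exp 2 / n ^ (1 / s)) ^ n)) := by
        gcongr
        exact norm_taylorPart_le hs hf hn
    _ = A ^ n * C * (√d * Real.exp 2 / n ^ (1 / s)) ^ n * ((n ! : ℝ) ^ g * √(n !)) := by ring
    _ ≤ A ^ n * C * (√d * Real.exp 2 / n ^ (1 / s)) ^ n * ((n : ℝ) ^ (g + 1 / 2)) ^ n := by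
        gcongr
    _ = C * (B * ((n : ℝ) ^ (g + 1 / 2) / (n : ℝ) ^ (1 / s))) ^ n := by
        simp only [B, mul_pow, div_pow]
        ring
    _ = C * (B * (n : ℝ) ^ (-ε)) ^ n := by rw [← Real.rpow_sub hn', neg_sub]
    _ ≤ C * (1 / 2) ^ n := by gcongr

end Growth

section Vanishing

variable {d : ℕ}

lemma isHomogeneous_sum_smul_X (z : EuclideanSpace ℂ (Fin d)) :
    (∑ i, z i • X i : MvPolynomial (Fin d) ℂ).IsHomogeneous 1 :=
  IsHomogeneous.sum _ _ _ fun i _ => by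
    rw [smul_eq_C_mul]
    exact (isHomogeneous_X ℂ i).C_mul (z i)

lemma entireOp_sum_smul_X_apply (f : entire (EuclideanSpace ℂ (Fin d)))
    (z w : EuclideanSpace ℂ (Fin d)) :
    (entireOp d (∑ i, z i • X i) f : EuclideanSpace ℂ (Fin d) → ℂ) w = fderiv ℂ f w z := by
  have hz : z = ∑ i, z i • EuclideanSpace.single i (1 : ℂ) := by
    ext j
    simp [Pi.single_apply]
  conv_rhs => rw [hz, map_sum]
  simp only [map_sum, map_smul, LinearMap.sum_apply, LinearMap.smul_apply,
    AddSubmonoidClass.coe_finsetSum, Finset.sum_apply, SetLike.val_smul, Pi.smul_apply,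
    coe_entireOp_X, partialD]

lemma iteratedDeriv_comp_smul_eq (f : entire (EuclideanSpace ℂ (Fin d)))
    (z : EuclideanSpace ℂ (Fin d)) (n : ℕ) :
    iteratedDeriv n (fun t : ℂ => (f : EuclideanSpace ℂ (Fin d) → ℂ) (t • z)) = fun t =>
      (entireOp d ((∑ i, z i • X i) ^ n) f : EuclideanSpace ℂ (Fin d) → ℂ) (t • z) := by
  induction n generalizing f with
  | zero => simp
  | succ n ih =>
    have hderiv : deriv (fun t : ℂ => (f : EuclideanSpace ℂ (Fin d) → ℂ) (t • z)) = fun t =>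
        (entireOp d (∑ i, z i • X i) f : EuclideanSpace ℂ (Fin d) → ℂ) (t • z) := funext fun t => by
      rw [entireOp_sum_smul_X_apply]
      simpa using (hasDerivAt_comp_line f.2 0 z t).deriv
    rw [iteratedDeriv_succ', hderiv, ih, pow_succ, map_mul (entireOp d), Module.End.mul_apply]

lemma eq_zero_of_taylorPart_eq_zero {f : entire (EuclideanSpace ℂ (Fin d))}
    (hf : ∀ n, taylorPart f n = 0) : f = 0 := by
  ext z
  have hvanish : ∀ n, iteratedDeriv n
      (fun t : ℂ => (f : EuclideanSpace ℂ (Fin d) → ℂ) (t • z)) 0 = 0 := fun n => by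
    have hinner := inner_taylorPart f
      (((isHomogeneous_sum_smul_X z).pow n).map (starRingEnd ℂ))
    rw [one_mul, hf, inner_zero_right, map_conj_map_conj] at hinner
    simp only [iteratedDeriv_comp_smul_eq, zero_smul]
    exact hinner.symm
  have hline : Differentiable ℂ fun t : ℂ => (f : EuclideanSpace ℂ (Fin d) → ℂ) (t • z) := by
    simpa using differentiable_comp_line f.2 0 z
  simpa [hvanish] using (Complex.taylorSeries_eq_of_entire hline 0 1).symm

lemma factorial_rpow_mul_norm_taylorPart_le {k β : ℕ} (hβ : β < k)
    {P : ℕ → MvPolynomial (Fin d) ℂ} (hP : ∀ j, (P j).IsHomogeneous j) (hPk : P k ≠ 0)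
    {f : entire (EuclideanSpace ℂ (Fin d))}
    (hf : entireOp d (map (starRingEnd ℂ) (P k))
      (polyFun d (∑ j ∈ Finset.range (β + 1), P j + P k) * f) = 0)
    {g : ℝ} (hg : 0 ≤ g) (hgβ : β ≤ 2 * g * (k - β)) (m : ℕ) :
    (m ! : ℝ) ^ g * ‖taylorPart f m‖ ≤ ∑ j ∈ Finset.range (β + 1),
      (∑ α ∈ (P j).support, ‖coeff α (P j)‖) * √k ^ j / ‖P k‖ *
        (((m + (k - j))! : ℝ) ^ g * ‖taylorPart f (m + (k - j))‖) := by
  have hPk_pos : 0 < ‖P k‖ := norm_pos_iff.2 hPk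
  have hweight : ∀ j ≤ β,
      (m ! : ℝ) ^ g * √(m + k) ^ j ≤ √k ^ j * ((m + (k - j))! : ℝ) ^ g := fun j hj => by
    refine factorial_rpow_mul_sqrt_pow_le (by lia) hg ?_ m
    rw [Nat.cast_sub (hj.trans hβ.le)]
    calc (j : ℝ) ≤ β := by exact_mod_cast hj
      _ ≤ 2 * g * (k - β) := hgβ
      _ ≤ 2 * g * (k - j) := by gcongr
  refine le_of_mul_le_mul_left ?_ hPk_pos
  calc ‖P k‖ * ((m ! : ℝ) ^ g * ‖taylorPart f m‖)
      = (m ! : ℝ) ^ g * (‖P k‖ * ‖taylorPart f m‖) := by ring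
    _ ≤ (m ! : ℝ) ^ g * ∑ j ∈ Finset.range (β + 1),
        (∑ α ∈ (P j).support, ‖coeff α (P j)‖) * √(m + k) ^ j * ‖taylorPart f (m + k - j)‖ := by
      gcongr
      exact norm_mul_norm_taylorPart_le f hβ hP hf m
    _ ≤ ‖P k‖ * ∑ j ∈ Finset.range (β + 1),
        (∑ α ∈ (P j).support, ‖coeff α (P j)‖) * √k ^ j / ‖P k‖ *
          (((m + (k - j))! : ℝ) ^ g * ‖taylorPart f (m + (k - j))‖) := by
      rw [Finset.mul_sum, Finset.mul_sum]
      refine Finset.sum_le_sum fun j hj => ?_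
      have hjβ : j ≤ β := Nat.lt_succ_iff.1 (Finset.mem_range.1 hj)
      have hterm := mul_le_mul_of_nonneg_left (hweight j hjβ) (mul_nonneg
        (Finset.sum_nonneg fun α (_ : α ∈ (P j).support) => norm_nonneg (coeff α (P j)))
        (norm_nonneg (taylorPart f (m + (k - j)))))
      rw [Nat.add_sub_assoc (hjβ.trans hβ.le)]
      refine (Eq.trans_le ?_ hterm).trans_eq ?_ <;> field_simp

lemma taylorPart_eq_zero {k β : ℕ} (hβ : β < k) {P : ℕ → MvPolynomial (Fin d) ℂ}
    (hP : ∀ j, (P j).IsHomogeneous j) (hPk : P k ≠ 0) {f : entire (EuclideanSpace ℂ (Fin d))}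
    (hf : entireOp d (map (starRingEnd ℂ) (P k))
      (polyFun d (∑ j ∈ Finset.range (β + 1), P j + P k) * f) = 0)
    (hord : order (f : EuclideanSpace ℂ (Fin d) → ℂ) < ((2 * (k - β) / k : ℝ) : EReal)) (n : ℕ) :
    taylorPart f n = 0 := by
  have hkβ : (0 : ℝ) < k - β := sub_pos.2 (by exact_mod_cast hβ)
  have hk : (0 : ℝ) < k := by exact_mod_cast β.zero_le.trans_lt hβ
  obtain ⟨s, hs, hsT, K, hK⟩ :=
    exists_pos_lt_forall_norm_le_of_order_lt f.2.continuous (by positivity) hord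
  set g : ℝ := β / (2 * (k - β)) with hg
  have hgs : g + 1 / 2 < 1 / s := by
    have hgT : g + 1 / 2 = 1 / (2 * (k - β) / k) := by
      rw [hg]
      field_simp
      ring
    rw [hgT]
    exact one_div_lt_one_div_of_lt hs hsT
  have hg_nonneg : 0 ≤ g := by positivity
  have hgβ : β ≤ 2 * g * (k - β) := le_of_eq (by rw [hg]; field_simp)
  let U : ℕ → ℝ := fun j => (∑ α ∈ (P j).support, ‖coeff α (P j)‖) * √k ^ j / ‖P k‖
  have hU : ∀ j, 0 ≤ U j := fun j => by positivity
  have hU_sum : 0 ≤ ∑ j ∈ Finset.range (β + 1), U j := Finset.sum_nonneg fun j _ => hU j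
  have hzero := eq_zero_of_le_sum_of_bddAbove (A := 1 + ∑ j ∈ Finset.range (β + 1), U j)
    (fun j _ => hU j) (fun j hj => by have := Finset.mem_range.1 hj; lia)
    (fun m => by positivity)
    (factorial_rpow_mul_norm_taylorPart_le hβ hP hPk hf hg_nonneg hgβ) (by linarith) (by linarith)
    (tendsto_pow_mul_factorial_rpow_mul_norm_taylorPart hs hK hg_nonneg hgs
      (by linarith)).bddAbove_range n
  exact norm_eq_zero.1 ((mul_eq_zero.1 hzero).resolve_left (by positivity))

lemma homogeneousComponent_totalDegree_ne_zero {σ R : Type*} [CommSemiring R]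
    {P : MvPolynomial σ R} (hP : P ≠ 0) : homogeneousComponent P.totalDegree P ≠ 0 := by
  obtain ⟨α, hα, hdegree⟩ := Finset.exists_mem_eq_sup P.support
    (Finset.nonempty_iff_ne_empty.2 (support_eq_empty.not.2 hP)) fun s => s.sum fun _ e => e
  refine ne_zero_iff.2 ⟨α, ?_⟩
  rw [coeff_homogeneousComponent, if_pos (show α.degree = P.totalDegree from hdegree.symm)]
  exact mem_support_iff.1 hα

end Vanishing

end Fischer

end

open Fischer in
theorem mainTheorem2_general (d k β : ℕ) (hβ : β < k)
    (P : MvPolynomial (Fin d) ℂ) (hdeg : P.totalDegree = k)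
    (hP : P = ∑ j ∈ Finset.range (β + 1), MvPolynomial.homogeneousComponent j P
      + MvPolynomial.homogeneousComponent k P)
    (φ : EuclideanSpace ℂ (Fin d) → ℂ) (hφ : Differentiable ℂ φ)
    (heq : ∀ z, Fischer.diffOp (Fischer.conjCoeffs (MvPolynomial.homogeneousComponent k P))
      (fun w => MvPolynomial.eval (fun i => w i) P * φ w) z = 0)
    (hord : Fischer.order φ < ((2 * ((k : ℝ) - (β : ℝ)) / (k : ℝ) : ℝ) : EReal)) :
    ∀ z, φ z = 0 := by
  let f : entire (EuclideanSpace ℂ (Fin d)) := ⟨φ, hφ⟩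
  have hPk : MvPolynomial.homogeneousComponent k P ≠ 0 := by
    have hP_ne : P ≠ 0 := fun h => by
      rw [h, MvPolynomial.totalDegree_zero] at hdeg
      lia
    exact hdeg ▸ homogeneousComponent_totalDegree_ne_zero hP_ne
  have hcoe : ((polyFun d P * f : entire (EuclideanSpace ℂ (Fin d))) :
      EuclideanSpace ℂ (Fin d) → ℂ) = fun w => MvPolynomial.eval (fun i => w i) P * φ w :=
    funext fun w => congrArg (· * φ w) (polyFun_apply P w)
  have hf : entireOp d (conjCoeffs (MvPolynomial.homogeneousComponent k P)) (polyFun d P * f) = 0 :=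
    Subtype.ext (funext fun z => by rw [entireOp_apply, hcoe]; exact heq z)
  have hf_zero : f = 0 := eq_zero_of_taylorPart_eq_zero <| taylorPart_eq_zero hβ
    (fun j => MvPolynomial.homogeneousComponent_isHomogeneous j P) hPk (hP ▸ hf) hord
  exact fun z => congrFun (congrArg Subtype.val hf_zero) z

theorem mainTheorem2 (d k β : ℕ) (hk : 2 ≤ k) (hβ : β ≤ k - 1)
    (P : MvPolynomial (Fin d) ℂ) (hdeg : P.totalDegree = k)
    (hnonhom : ¬ ∃ m : ℕ, P.IsHomogeneous m)
    (hP : P = ∑ j ∈ Finset.range (β + 1), MvPolynomial.homogeneousComponent j P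
      + MvPolynomial.homogeneousComponent k P)
    (φ : EuclideanSpace ℂ (Fin d) → ℂ) (hφ : Differentiable ℂ φ)
    (heq : ∀ z, Fischer.diffOp (Fischer.conjCoeffs (MvPolynomial.homogeneousComponent k P))
      (fun w => MvPolynomial.eval (fun i => w i) P * φ w) z = 0)
    (hord : Fischer.order φ < ((2 * ((k : ℝ) - (β : ℝ)) / (k : ℝ) : ℝ) : EReal)) :
    ∀ z, φ z = 0 :=
  mainTheorem2_general d k β (by lia) P hdeg hP φ hφ heq hord
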